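/- Let $X$ and $Z$ be reduced complex spaces and let $h:Z\to X$ be a surjective holomorphic submersion, i.e. a holomorphic map such that every point of $Z$ has an open neighbourhood which is fibrewise biholomorphic (over $X$) to an open subset of $X\times\mathbb{C}^m$ for some $m\ge 0$. For an open set $U\subset X$ let $\Psi(U)$ denote the space of continuous sections $U\to Z$ of $h$ over $U$ with the compact-open topology, and let $\Phi(U)\subset\Psi(U)$ be the subspace of holomorphic sections. (a) For every point $x_0\in X$, open neighbourhood $U\subset X$ of $x_0$, closed ball $B$ of positive radius in some $\mathbb{R}^n$ $(n\ge 0)$ with boundary sphere $bB$, and continuous map $f:B\to\Psi(U)$ such that $f(bB)\subset\Phi(U)$, there are an open neighbourhood $V\subset U$ of $x_0$ and a homotopy $f_t:B\to\Psi(V)$ $(t\in[0,1])$ such that $f_0=f|_V$, $f_t|_{bB}$ is independent of $t$ (hence it equals $f|_V$ on $bB$ for all $t\in[0,1]$), and $f_1$ has values in $\Phi(V)$. (b) The inclusion $\Phi\hookrightarrow\Psi$ is a local weak homotopy equivalence: for every $x_0\in X$ it induces a bijection $\varinjlim_{U\ni x_0}\pi_0(\Phi(U))\to\varinjlim_{U\ni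 x_0}\pi_0(\Psi(U))$ and, for every holomorphic section $\sigma$ of $h$ on a neighbourhood of $x_0$ and every $k\ge 1$, a bijection $\varinjlim_{U\ni x_0}\pi_k(\Phi(U),\sigma|_U)\to\varinjlim_{U\ni x_0}\pi_k(\Psi(U),\sigma|_U)$, where $U$ runs over the (small) open neighbourhoods of $x_0$. -/

import Mathlib

open Topology Set TopologicalSpace

/-! ### Reduced complex spaces

The structure sheaf of a reduced complex space is a sheaf of complex valued functions. It is
recorded by the predicate `HolAt f x`: the germ at `x` of the function `f` belongs to the stalk of
the structure sheaf at `x` (so `f` is a section over an open set `U` iff `HolAt f x` for all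
`x ∈ U`). -/

/-- `φ : U → ℂ^ι` is a holomorphic chart of `X` on the open set `U` with respect to the structure
sheaf given by `HolAt`: it is a homeomorphism from `U` onto the common zero set `A` of finitely many
holomorphic functions `g k` on an open set `Ω ⊆ ℂ^ι`, and the germs of structure functions at the
points of `U` are precisely the pullbacks of the restrictions to `A` of holomorphic germs on
`ℂ^ι`. -/
structure IsHolChart {X : Type*} [TopologicalSpace X] (HolAt : (X → ℂ) → X → Prop) {ι κ : Type}
    [Fintype ι] [Fintype κ] (U : Set X) (φ : X → ι → ℂ) (Ω : Set (ι → ℂ))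
    (g : (ι → ℂ) → κ → ℂ) : Prop where
  isOpen_source : IsOpen U
  isOpen_ambient : IsOpen Ω
  analytic : AnalyticOnNhd ℂ g Ω
  embedding : IsEmbedding (U.domRestrict φ)
  image_eq : φ '' U = {w | w ∈ Ω ∧ ∀ k, g w k = 0}
  holAt_iff : ∀ y ∈ U, ∀ f : X → ℂ,
    HolAt f y ↔ ∃ G : (ι → ℂ) → ℂ, AnalyticAt ℂ G (φ y) ∧ f =ᶠ[𝓝 y] fun x => G (φ x)

/-- A reduced complex space: a Hausdorff space with a sheaf of complex valued functions which is
locally isomorphic to an analytic subset of an open set in some `ℂ^ι`, with its sheaf of functions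
that are locally restrictions of holomorphic functions. -/
class ReducedComplexSpace (X : Type*) [TopologicalSpace X] extends T2Space X where
  HolAt : (X → ℂ) → X → Prop
  exists_chart : ∀ x : X, ∃ (ι κ : Type) (_ : Fintype ι) (_ : Fintype κ) (U : Set X)
    (φ : X → ι → ℂ) (Ω : Set (ι → ℂ)) (g : (ι → ℂ) → κ → ℂ),
    x ∈ U ∧ IsHolChart HolAt U φ Ω g

namespace ReducedComplexSpace

/-- The complex Euclidean space `ℂ^ι`. -/
instance instPi (ι : Type) [Fintype ι] : ReducedComplexSpace (ι → ℂ) where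
  HolAt f x := AnalyticAt ℂ f x
  exists_chart x := by
    refine ⟨ι, Empty, inferInstance, inferInstance, univ, id, univ, fun _ _ => 0, mem_univ x, ?_⟩
    refine ⟨isOpen_univ, isOpen_univ, analyticOnNhd_const, ?_, ?_, ?_⟩
    · exact IsEmbedding.subtypeVal
    · simp
    · intro y _ f
      constructor
      · intro h
        exact ⟨f, h, Filter.EventuallyEq.rfl⟩
      · rintro ⟨G, hG, hf⟩
        exact AnalyticAt.congr hG hf.symm

/-- An open subspace of a reduced complex space, with the restricted structure sheaf. -/
instance instOpens {X : Type*} [TopologicalSpace X] [ReducedComplexSpace X] (O : Opens X) :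
    ReducedComplexSpace O where
  HolAt f x := ∃ F : X → ℂ, HolAt F (x : X) ∧ f =ᶠ[𝓝 x] fun y => F y
  exists_chart x := by
    obtain ⟨ι, κ, iι, iκ, U, φ, Ω, g, hxU, hc⟩ := exists_chart (x : X)
    obtain ⟨W, hW, hWU⟩ := hc.embedding.isOpen_iff.1
      (O.isOpen.preimage (continuous_subtype_val (p := (· ∈ U))))
    refine ⟨ι, κ, iι, iκ, Subtype.val ⁻¹' U, fun y => φ y, Ω ∩ W, g, hxU,
      hc.isOpen_source.preimage continuous_subtype_val, hc.isOpen_ambient.inter hW,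
      hc.analytic.mono inter_subset_left, ?_, ?_, ?_⟩
    · have : IsEmbedding (fun y : (Subtype.val ⁻¹' U : Set O) => (⟨y.1.1, y.2⟩ : U)) := by
        refine IsEmbedding.of_comp (by fun_prop) continuous_subtype_val ?_
        exact (IsEmbedding.subtypeVal (p := fun y : X => y ∈ O)).comp
          (IsEmbedding.subtypeVal (p := fun y : O => (y : X) ∈ U))
      exact hc.embedding.comp this
    · have key : ∀ y (hy : y ∈ U), φ y ∈ W ↔ y ∈ O := fun y hy => by
        have := congrArg (fun s => (⟨y, hy⟩ : U) ∈ s) hWU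
        simpa [Set.domRestrict] using this
      have hi := hc.image_eq
      ext w
      constructor
      · rintro ⟨y, hy, rfl⟩
        have h1 : φ y ∈ φ '' U := ⟨y, hy, rfl⟩
        rw [hi] at h1
        exact ⟨⟨h1.1, (key _ hy).2 y.2⟩, h1.2⟩
      · rintro ⟨⟨h1, h2⟩, h3⟩
        have h4 : w ∈ φ '' U := by
          rw [hi]
          exact ⟨h1, h3⟩
        obtain ⟨y, hy, rfl⟩ := h4
        exact ⟨⟨y, (key _ hy).1 h2⟩, hy, rfl⟩
    · intro y hy f
      constructor
      · rintro ⟨F, hF, hf⟩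
        obtain ⟨G, hG, hFG⟩ := (hc.holAt_iff y hy F).1 hF
        refine ⟨G, hG, hf.trans ?_⟩
        exact (continuous_subtype_val.tendsto y).eventually hFG
      · rintro ⟨G, hG, hf⟩
        exact ⟨fun x => G (φ x), (hc.holAt_iff y hy _).2 ⟨G, hG, Filter.EventuallyEq.rfl⟩, hf⟩

/-- The product of two reduced complex spaces: the structure functions are locally the functions
`G (a₁(x), …, a_r(x), b₁(y), …, b_s(y))` with `G` holomorphic and `a_i`, `b_j` structure functions
on the factors. -/
instance instProd {X Y : Type*} [TopologicalSpace X] [TopologicalSpace Y] [ReducedComplexSpace X]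
    [ReducedComplexSpace Y] : ReducedComplexSpace (X × Y) where
  HolAt F p := ∃ (r s : ℕ) (a : X → Fin r → ℂ) (b : Y → Fin s → ℂ)
    (G : (Fin r → ℂ) × (Fin s → ℂ) → ℂ),
    (∀ i, HolAt (fun x => a x i) p.1) ∧ (∀ j, HolAt (fun y => b y j) p.2) ∧
    AnalyticAt ℂ G (a p.1, b p.2) ∧ F =ᶠ[𝓝 p] fun q => G (a q.1, b q.2)
  exists_chart := by
    rintro ⟨x, y⟩
    obtain ⟨ι, κ, iι, iκ, U, φ, Ω, g, hxU, hc⟩ := exists_chart x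
    obtain ⟨ι', κ', iι', iκ', U', φ', Ω', g', hyU, hc'⟩ := exists_chart y
    let L : (ι ⊕ ι' → ℂ) →L[ℂ] (ι → ℂ) := ContinuousLinearMap.pi fun i => .proj (.inl i)
    let R : (ι ⊕ ι' → ℂ) →L[ℂ] (ι' → ℂ) := ContinuousLinearMap.pi fun i => .proj (.inr i)
    refine ⟨ι ⊕ ι', κ ⊕ κ', inferInstance, inferInstance, U ×ˢ U',
      fun p => Sum.elim (φ p.1) (φ' p.2), L ⁻¹' Ω ∩ R ⁻¹' Ω',
      fun w => Sum.elim (g (L w)) (g' (R w)), ⟨hxU, hyU⟩,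
      hc.isOpen_source.prod hc'.isOpen_source,
      (hc.isOpen_ambient.preimage L.continuous).inter (hc'.isOpen_ambient.preimage R.continuous),
      ?_, ?_, ?_, ?_⟩
    · intro w hw
      rw [analyticAt_pi_iff]
      rintro (k | k)
      · exact (analyticAt_pi_iff.1 (hc.analytic _ hw.1) k).comp (L.analyticAt w)
      · exact (analyticAt_pi_iff.1 (hc'.analytic _ hw.2) k).comp (R.analyticAt w)
    · have hc1 : ContinuousOn φ U := continuousOn_iff_continuous_domRestrict.2 hc.embedding.continuous
      have hc2 : ContinuousOn φ' U' :=
        continuousOn_iff_continuous_domRestrict.2 hc'.embedding.continuous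
      have h1 := (hc.embedding.prodMap hc'.embedding).comp
        (Homeomorph.Set.prod U U').isEmbedding
      refine IsEmbedding.of_comp ?_ (L.continuous.prodMk R.continuous) h1
      refine continuousOn_iff_continuous_domRestrict.1 (continuousOn_pi.2 ?_)
      rintro (k | k)
      · exact (continuousOn_pi.1 hc1 k).comp continuousOn_fst fun p hp => hp.1
      · exact (continuousOn_pi.1 hc2 k).comp continuousOn_snd fun p hp => hp.2
    · have hi := hc.image_eq
      have hi' := hc'.image_eq
      ext w
      constructor
      · rintro ⟨⟨p, q⟩, ⟨hp, hq⟩, rfl⟩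
        have h1 : φ p ∈ φ '' U := ⟨p, hp, rfl⟩
        have h2 : φ' q ∈ φ' '' U' := ⟨q, hq, rfl⟩
        rw [hi] at h1
        rw [hi'] at h2
        refine ⟨⟨h1.1, h2.1⟩, ?_⟩
        rintro (k | k)
        · exact h1.2 k
        · exact h2.2 k
      · rintro ⟨⟨h1, h2⟩, h3⟩
        have h4 : L w ∈ φ '' U := by
          rw [hi]
          exact ⟨h1, fun k => h3 (.inl k)⟩
        have h5 : R w ∈ φ' '' U' := by
          rw [hi']
          exact ⟨h2, fun k => h3 (.inr k)⟩
        obtain ⟨p, hp, hp'⟩ := h4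
        obtain ⟨q, hq, hq'⟩ := h5
        refine ⟨(p, q), ⟨hp, hq⟩, ?_⟩
        funext k
        rcases k with k | k
        · exact congrFun hp' k
        · exact congrFun hq' k
    · rintro ⟨p, q⟩ ⟨hp, hq⟩ f
      constructor
      · rintro ⟨r, s, a, b, G, ha, hb, hG, hf⟩
        choose A hA hA' using fun i => (hc.holAt_iff p hp _).1 (ha i)
        choose B hB hB' using fun j => (hc'.holAt_iff q hq _).1 (hb j)
        have ea : a p = fun i => A i (φ p) := funext fun i => (hA' i).self_of_nhds
        have eb : b q = fun j => B j (φ' q) := funext fun j => (hB' j).self_of_nhds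
        have hAL : AnalyticAt ℂ (fun w i => A i (L w)) (Sum.elim (φ p) (φ' q)) :=
          analyticAt_pi_iff.2 fun i => AnalyticAt.comp (hA i) (L.analyticAt _)
        have hBR : AnalyticAt ℂ (fun w j => B j (R w)) (Sum.elim (φ p) (φ' q)) :=
          analyticAt_pi_iff.2 fun j => AnalyticAt.comp (hB j) (R.analyticAt _)
        refine ⟨fun w => G (fun i => A i (L w), fun j => B j (R w)), ?_, ?_⟩
        · refine AnalyticAt.comp (g := G) ?_ (hAL.prod hBR)
          simp only [ea, eb] at hG
          exact hG
        · have h1 : ∀ᶠ z : X × Y in 𝓝 (p, q), ∀ i, a z.1 i = A i (φ z.1) :=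
            (continuous_fst.tendsto (p, q)).eventually (Filter.eventually_all.2 hA')
          have h2 : ∀ᶠ z : X × Y in 𝓝 (p, q), ∀ j, b z.2 j = B j (φ' z.2) :=
            (continuous_snd.tendsto (p, q)).eventually (Filter.eventually_all.2 hB')
          filter_upwards [hf, h1, h2] with z hz hz1 hz2
          rw [hz, funext hz1, funext hz2]
          rfl
      · rintro ⟨G, hG, hf⟩
        let e := Fintype.equivFin ι
        let e' := Fintype.equivFin ι'
        let S : (Fin (Fintype.card ι) → ℂ) × (Fin (Fintype.card ι') → ℂ) →L[ℂ] (ι ⊕ ι' → ℂ) :=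
          ContinuousLinearMap.pi (Sum.rec
            (fun i => (ContinuousLinearMap.proj (e i)).comp (.fst ℂ _ _))
            (fun i => (ContinuousLinearMap.proj (e' i)).comp (.snd ℂ _ _)))
        have hS : ∀ u v, S (fun i => u (e.symm i), fun j => v (e'.symm j)) = Sum.elim u v := by
          intro u v
          funext k
          rcases k with k | k
          · simp [S]
          · simp [S]
        refine ⟨_, _, fun x i => φ x (e.symm i), fun y j => φ' y (e'.symm j), fun w => G (S w),
          ?_, ?_, ?_, ?_⟩
        · intro i
          exact (hc.holAt_iff p hp _).2 ⟨fun w => w (e.symm i),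
            (ContinuousLinearMap.proj (R := ℂ) (φ := fun _ : ι => ℂ) (e.symm i)).analyticAt _,
            Filter.EventuallyEq.rfl⟩
        · intro i
          exact (hc'.holAt_iff q hq _).2 ⟨fun w => w (e'.symm i),
            (ContinuousLinearMap.proj (R := ℂ) (φ := fun _ : ι' => ℂ) (e'.symm i)).analyticAt _,
            Filter.EventuallyEq.rfl⟩
        · refine AnalyticAt.comp (g := G) ?_ (S.analyticAt _)
          rw [hS]
          exact hG
        · filter_upwards [hf] with z hz
          rw [hz, hS]

end ReducedComplexSpace

section Submersions

variable {X Z : Type*} [TopologicalSpace X] [TopologicalSpace Z] [ReducedComplexSpace X]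
  [ReducedComplexSpace Z]

/-- A map of reduced complex spaces is holomorphic at `z` if it is continuous at `z` and pulls back
germs of structure functions to germs of structure functions. -/
def HolomorphicMapAt (h : Z → X) (z : Z) : Prop :=
  ContinuousAt h z ∧ ∀ f : X → ℂ,
    ReducedComplexSpace.HolAt f (h z) → ReducedComplexSpace.HolAt (fun y => f (h y)) z

/-- Holomorphic maps of reduced complex spaces. -/
def HolomorphicMap (h : Z → X) : Prop := ∀ z, HolomorphicMapAt h z

/-- A holomorphic submersion: a holomorphic map which, near each point of `Z`, is isomorphic by a
biholomorphic map `e` to the projection to `X` of an open subset of `X × ℂ^m`. -/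
structure IsHolomorphicSubmersion (h : Z → X) : Prop where
  holomorphic : HolomorphicMap h
  exists_chart : ∀ z : Z, ∃ (m : ℕ) (e : OpenPartialHomeomorph Z (X × (Fin m → ℂ))),
    z ∈ e.source ∧ (∀ y ∈ e.source, (e y).1 = h y) ∧
    (∀ y ∈ e.source, HolomorphicMapAt e y) ∧ (∀ w ∈ e.target, HolomorphicMapAt e.symm w)

/-- The space `Ψ(U)` of continuous sections of `h : Z → X` over the open set `U`, with the
compact-open topology. -/
abbrev ContSections (h : Z → X) (U : Opens X) : Type _ :=
  {s : C(U, Z) // ∀ x : U, h (s x) = x}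

/-- The space `Φ(U)` of holomorphic sections of `h : Z → X` over the open set `U`, with the
compact-open topology. -/
abbrev HolSections (h : Z → X) (U : Opens X) : Type _ :=
  {s : ContSections h U // HolomorphicMap (s.1 : U → Z)}

/-- The inclusion `Φ(U) ↪ Ψ(U)`. -/
def holInclusion (h : Z → X) (U : Opens X) : C(HolSections h U, ContSections h U) :=
  ⟨Subtype.val, continuous_subtype_val⟩

/-- The restriction map `Ψ(U) → Ψ(V)` for `V ⊆ U`. -/
def contRestrict (h : Z → X) {U V : Opens X} (hVU : V ≤ U) :
    C(ContSections h U, ContSections h V) where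
  toFun s := ⟨s.1.comp ⟨Opens.inclusion hVU, by fun_prop⟩,
    fun x => s.2 (Opens.inclusion hVU x)⟩
  continuous_toFun := by
    refine Continuous.subtype_mk ?_ _
    exact (ContinuousMap.continuous_precomp _).comp continuous_subtype_val

theorem HolomorphicMap.comp_inclusion {U V : Opens X} (hVU : V ≤ U) {s : U → Z}
    (hs : HolomorphicMap s) : HolomorphicMap fun x : V => s (Opens.inclusion hVU x) := by
  intro x
  have hi : Continuous (Opens.inclusion hVU) := continuous_inclusion hVU
  refine ⟨(hs (Opens.inclusion hVU x)).1.comp hi.continuousAt, fun f hf => ?_⟩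
  obtain ⟨F, hF, hFs⟩ := (hs (Opens.inclusion hVU x)).2 f hf
  exact ⟨F, hF, (hi.tendsto x).eventually hFs⟩

/-- The restriction map `Φ(U) → Φ(V)` for `V ⊆ U`. -/
def holRestrict (h : Z → X) {U V : Opens X} (hVU : V ≤ U) :
    C(HolSections h U, HolSections h V) where
  toFun s := ⟨contRestrict h hVU s.1, s.2.comp_inclusion hVU⟩
  continuous_toFun :=
    Continuous.subtype_mk ((contRestrict h hVU).continuous.comp continuous_subtype_val) _

/-- The map `π_n(A, a) → π_n(B, f a)` induced by a continuous map `f : A → B`. -/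
def homotopyGroupMap {A B : Type*} [TopologicalSpace A] [TopologicalSpace B] (n : ℕ) (f : C(A, B))
    (a : A) : HomotopyGroup.Pi n A a → HomotopyGroup.Pi n B (f a) :=
  Quotient.map' (fun γ => ⟨f.comp γ.1, fun y hy => congrArg f (γ.2 y hy)⟩)
    fun _ _ H => H.map fun K => K.compContinuousMap f

/-- The inclusion `Φ ↪ Ψ` of the sheaf of holomorphic sections of `h` into the sheaf of continuous
sections is a local weak homotopy equivalence: at every point `x₀` it induces bijections
`colim π₀(Φ(U)) → colim π₀(Ψ(U))` and `colim πₙ(Φ(U), σ) → colim πₙ(Ψ(U), σ)`, the direct limits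
being over the open neighbourhoods `U` of `x₀`, and `σ` being any holomorphic section near `x₀`.
The bijectivity of these maps of direct limits is spelled out. -/
structure IsLocalWeakHomotopyEquiv (h : Z → X) : Prop where
  pi_zero_surjective : ∀ (x₀ : X) (U : Opens X), x₀ ∈ U → ∀ s : ContSections h U,
    ∃ (V : Opens X) (hVU : V ≤ U), x₀ ∈ V ∧ ∃ σ : HolSections h V,
      Joined (holInclusion h V σ) (contRestrict h hVU s)
  pi_zero_injective : ∀ (x₀ : X) (U : Opens X), x₀ ∈ U → ∀ σ τ : HolSections h U,
    Joined (holInclusion h U σ) (holInclusion h U τ) →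
    ∃ (V : Opens X) (hVU : V ≤ U), x₀ ∈ V ∧ Joined (holRestrict h hVU σ) (holRestrict h hVU τ)
  pi_surjective : ∀ (x₀ : X) (U : Opens X), x₀ ∈ U → ∀ (σ : HolSections h U) (n : ℕ), 1 ≤ n →
    ∀ α : HomotopyGroup.Pi n (ContSections h U) (holInclusion h U σ),
    ∃ (V : Opens X) (hVU : V ≤ U), x₀ ∈ V ∧
      ∃ β : HomotopyGroup.Pi n (HolSections h V) (holRestrict h hVU σ),
        homotopyGroupMap n (holInclusion h V) (holRestrict h hVU σ) β =
          homotopyGroupMap n (contRestrict h hVU) (holInclusion h U σ) α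
  pi_injective : ∀ (x₀ : X) (U : Opens X), x₀ ∈ U → ∀ (σ : HolSections h U) (n : ℕ), 1 ≤ n →
    ∀ α β : HomotopyGroup.Pi n (HolSections h U) σ,
    homotopyGroupMap n (holInclusion h U) σ α = homotopyGroupMap n (holInclusion h U) σ β →
    ∃ (V : Opens X) (hVU : V ≤ U), x₀ ∈ V ∧
      homotopyGroupMap n (holRestrict h hVU) σ α = homotopyGroupMap n (holRestrict h hVU) σ β

end Submersions

/-! ### Calculus of structure functions and holomorphic maps. -/

section ComplexSpaces

variable {X Y Z : Type*} [TopologicalSpace X] [TopologicalSpace Y] [TopologicalSpace Z]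
  [ReducedComplexSpace X] [ReducedComplexSpace Y] [ReducedComplexSpace Z]

/-! Near `x₀` a section can be replaced by the one that is constant in a submersion chart and has
the same value at `x₀`; that section is holomorphic, and the linear interpolation in the fibre
coordinate joins the two after shrinking the neighbourhood. For a compact family of sections one
chart does not suffice, so the interpolation is done with a cutoff in the parameter
(`exists_deformableOn`), one small parameter set at a time (`DeformableOn.union`). The steps do not
disturb each other: each fixes the values at `x₀`, and each preserves holomorphy, since for a fixed
parameter the interpolation weight is constant on `X`. To keep the boundary sphere fixed, the family
is first stretched radially (`exists_radial_stretch`), so that it is holomorphic on an outer shell;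
a second cutoff `ρ` that vanishes on the sphere then fades the deformation out inside that shell.
This is (a). Cubes and prisms are balls for the sup norm, so (a) in arbitrary finite dimensional
norms gives (b). -/

theorem ReducedComplexSpace.HolAt.congr {f g : X → ℂ} {x : X}
    (hf : ReducedComplexSpace.HolAt f x) (hfg : f =ᶠ[𝓝 x] g) : ReducedComplexSpace.HolAt g x := by
  obtain ⟨ι, κ, iι, iκ, U, φ, Ω, g', hxU, hc⟩ := ReducedComplexSpace.exists_chart x
  obtain ⟨G, hG, hG'⟩ := (hc.holAt_iff x hxU f).1 hf
  exact (hc.holAt_iff x hxU g).2 ⟨G, hG, hfg.symm.trans hG'⟩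

theorem ReducedComplexSpace.holAt_const (c : ℂ) (x : X) :
    ReducedComplexSpace.HolAt (fun _ => c) x := by
  obtain ⟨ι, κ, iι, iκ, U, φ, Ω, g', hxU, hc⟩ := ReducedComplexSpace.exists_chart x
  exact (hc.holAt_iff x hxU _).2 ⟨fun _ => c, analyticAt_const, Filter.EventuallyEq.rfl⟩

/-- A holomorphic function of structure functions is a structure function. -/
theorem ReducedComplexSpace.HolAt.analyticAt_comp {ι : Type*} [Fintype ι] {u : X → ι → ℂ}
    {G : (ι → ℂ) → ℂ} {x : X} (hu : ∀ i, ReducedComplexSpace.HolAt (fun y => u y i) x)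
    (hG : AnalyticAt ℂ G (u x)) : ReducedComplexSpace.HolAt (fun y => G (u y)) x := by
  obtain ⟨ι', κ, iι, iκ, U, φ, Ω, g', hxU, hc⟩ := ReducedComplexSpace.exists_chart x
  choose A hA hA' using fun i => (hc.holAt_iff x hxU _).1 (hu i)
  have e : u x = fun i => A i (φ x) := funext fun i => (hA' i).self_of_nhds
  refine (hc.holAt_iff x hxU _).2 ⟨fun w => G fun i => A i w, ?_, ?_⟩
  · refine AnalyticAt.comp (g := G) ?_ (analyticAt_pi_iff.2 hA)
    rwa [e] at hG
  · filter_upwards [Filter.eventually_all.2 hA'] with y hy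
    rw [funext hy]

/-- A chart image is an open set intersected with the closed complement of `Ω ∩ {g ≠ 0}`. Local
compactness is what makes evaluation of sections jointly continuous in `continuous_eval_sections`.
-/
instance ReducedComplexSpace.locallyCompactSpace : LocallyCompactSpace X := by
  have : WeaklyLocallyCompactSpace X := by
    refine ⟨fun x => ?_⟩
    obtain ⟨ι, κ, iι, iκ, U, φ, Ω, g, hxU, hc⟩ := ReducedComplexSpace.exists_chart x
    have hlc : IsLocallyClosed (range (U.domRestrict φ)) := by
      have hr : range (U.domRestrict φ) = Ω ∩ (Ω ∩ g ⁻¹' {0}ᶜ)ᶜ := by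
        rw [range_domRestrict, hc.image_eq]
        ext w
        simp only [mem_ofPred_eq, mem_inter_iff, mem_compl_iff, mem_preimage, mem_singleton_iff,
          not_and, not_not, funext_iff, Pi.zero_apply]
        tauto
      rw [hr]
      exact hc.isOpen_ambient.isLocallyClosed.inter
        (hc.analytic.continuousOn.isOpen_inter_preimage hc.isOpen_ambient
          isOpen_compl_singleton).isClosed_compl.isLocallyClosed
    have := hc.embedding.isInducing.locallyCompactSpace hlc
    obtain ⟨K, hK, hxK⟩ := exists_compact_mem_nhds (⟨x, hxU⟩ : U)
    exact ⟨Subtype.val '' K, hK.image continuous_subtype_val,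
      hc.isOpen_source.isOpenMap_subtype_val.image_mem_nhds hxK⟩
  infer_instance

theorem HolomorphicMapAt.comp {g : Y → Z} {f : X → Y} {x : X} (hg : HolomorphicMapAt g (f x))
    (hf : HolomorphicMapAt f x) : HolomorphicMapAt (fun y => g (f y)) x :=
  ⟨hg.1.comp hf.1, fun F hF => hf.2 _ (hg.2 F hF)⟩

theorem HolomorphicMapAt.congr {f g : X → Y} {x : X} (hf : HolomorphicMapAt f x)
    (hfg : f =ᶠ[𝓝 x] g) : HolomorphicMapAt g x := by
  refine ⟨hf.1.congr hfg, fun F hF => ?_⟩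
  rw [← hfg.self_of_nhds] at hF
  exact (hf.2 F hF).congr (hfg.fun_comp F)

theorem holomorphicMap_subtype_val (U : Opens X) : HolomorphicMap (Subtype.val : U → X) :=
  fun _ => ⟨continuous_subtype_val.continuousAt, fun f hf => ⟨f, hf, Filter.EventuallyEq.rfl⟩⟩

/-- A map into `Y × ℂ^m` is holomorphic if its component in `Y` is holomorphic and its coordinates
in `ℂ^m` are structure functions. -/
theorem HolomorphicMapAt.prodMk_pi {m : ℕ} {a : X → Y} {w : X → Fin m → ℂ} {x : X}
    (ha : HolomorphicMapAt a x) (hwc : ContinuousAt w x)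
    (hw : ∀ j, ReducedComplexSpace.HolAt (fun y => w y j) x) :
    HolomorphicMapAt (fun y => (a y, w y)) x := by
  refine ⟨ha.1.prodMk hwc, ?_⟩
  rintro F ⟨r, s, b, c, G, hb, hc, hG, hF⟩
  let S : (Fin r ⊕ Fin s → ℂ) →L[ℂ] (Fin r → ℂ) × (Fin s → ℂ) :=
    (ContinuousLinearMap.pi fun i => .proj (.inl i)).prod
      (ContinuousLinearMap.pi fun i => .proj (.inr i))
  have hu : ∀ i, ReducedComplexSpace.HolAt
      (fun y => Sum.elim (b (a y)) (c (w y)) i) x := by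
    rintro (i | j)
    · exact ha.2 _ (hb i)
    · exact ReducedComplexSpace.HolAt.analyticAt_comp hw (hc j)
  have key := ReducedComplexSpace.HolAt.analyticAt_comp (G := fun v => G (S v)) hu
    (AnalyticAt.comp (g := G) hG (S.analyticAt _))
  refine key.congr ?_
  exact ((ha.1.prodMk hwc).eventually hF).mono fun y hy => hy.symm

theorem HolomorphicMapAt.holAt_snd {m : ℕ} {f : X → Y × (Fin m → ℂ)} {x : X}
    (hf : HolomorphicMapAt f x) (j : Fin m) :
    ReducedComplexSpace.HolAt (fun y => (f y).2 j) x := by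
  refine hf.2 (fun q => q.2 j) ⟨0, 1, fun _ => Fin.elim0, fun w _ => w j, fun q => q.2 0,
    fun i => i.elim0, fun _ => ?_, ?_, Filter.EventuallyEq.rfl⟩
  · exact (ContinuousLinearMap.proj (R := ℂ) (φ := fun _ : Fin m => ℂ) j).analyticAt _
  · exact ((ContinuousLinearMap.proj (R := ℂ) (φ := fun _ : Fin 1 => ℂ) 0).comp
      (.snd ℂ (Fin 0 → ℂ) (Fin 1 → ℂ))).analyticAt _

theorem HolomorphicMapAt.comp_inclusion {U V : Opens X} (hVU : V ≤ U) {s : U → Z} {x : V}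
    (hs : HolomorphicMapAt s (Opens.inclusion hVU x)) :
    HolomorphicMapAt (fun y : V => s (Opens.inclusion hVU y)) x := by
  have hi : Continuous (Opens.inclusion hVU) := continuous_inclusion hVU
  refine ⟨hs.1.comp hi.continuousAt, fun f hf => ?_⟩
  obtain ⟨F, hF, hFs⟩ := hs.2 f hf
  exact ⟨F, hF, (hi.tendsto x).eventually hFs⟩

end ComplexSpaces

/-! ### Deforming compact families towards chart-constant sections. -/

section Deformations

variable {X Z K : Type*} [TopologicalSpace X] [TopologicalSpace Z] [ReducedComplexSpace X]
  [ReducedComplexSpace Z] {h : Z → X}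

/-- Any family of continuous sections near `x₀` with values `F₀ p` at `x₀` can be deformed near
`x₀`, rel `{ρ = 0}`, to a family with the same values at `x₀` which is holomorphic for `p ∈ S` with
`ρ p = 1`, the deformation preserving holomorphy. -/
def DeformableOn [TopologicalSpace K] (h : Z → X) (x₀ : X) (ρ : C(K, ℝ)) (F₀ : K → Z)
    (S : Set K) : Prop :=
  ∀ (U : Opens X) (hU : x₀ ∈ U) (f : C(K, ContSections h U)),
    (∀ p, (f p).1 ⟨x₀, hU⟩ = F₀ p) →
    ∃ (V : Opens X) (hVU : V ≤ U) (hV : x₀ ∈ V) (g : C(K, ContSections h V)),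
      ((contRestrict h hVU).comp f).HomotopicRel g {p | ρ p = 0} ∧
      (∀ p, (g p).1 ⟨x₀, hV⟩ = F₀ p) ∧
      (∀ p (x : V), HolomorphicMapAt (f p).1 (Opens.inclusion hVU x) →
        HolomorphicMapAt (g p).1 x) ∧
      ∀ p ∈ S, ρ p = 1 → HolomorphicMap ((g p).1 : V → Z)

theorem DeformableOn.mono [TopologicalSpace K] {x₀ : X} {ρ : C(K, ℝ)} {F₀ : K → Z} {S T : Set K}
    (hST : S ⊆ T) (hT : DeformableOn h x₀ ρ F₀ T) : DeformableOn h x₀ ρ F₀ S := by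
  intro U hU f hf
  obtain ⟨V, hVU, hV, g, h1, h2, h3, h4⟩ := hT U hU f hf
  exact ⟨V, hVU, hV, g, h1, h2, h3, fun p hp => h4 p (hST hp)⟩

theorem deformableOn_empty [TopologicalSpace K] (x₀ : X) (ρ : C(K, ℝ)) (F₀ : K → Z) :
    DeformableOn h x₀ ρ F₀ ∅ :=
  fun U hU f hf => ⟨U, le_rfl, hU, f, ContinuousMap.HomotopicRel.refl _, hf, fun _ _ hp => hp,
    fun _ hp => hp.elim⟩

/-- The second deformation is applied to the result of the first. It applies because the values at
`x₀` are still `F₀`, and it keeps what was gained on `S` because it preserves holomorphy. -/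
theorem DeformableOn.union [TopologicalSpace K] {x₀ : X} {ρ : C(K, ℝ)} {F₀ : K → Z} {S T : Set K}
    (hS : DeformableOn h x₀ ρ F₀ S) (hT : DeformableOn h x₀ ρ F₀ T) :
    DeformableOn h x₀ ρ F₀ (S ∪ T) := by
  intro U hU f hf
  obtain ⟨V, hVU, hV, g, h1, h2, h3, h4⟩ := hS U hU f hf
  obtain ⟨W, hWV, hW, k, k1, k2, k3, k4⟩ := hT V hV g h2
  refine ⟨W, hWV.trans hVU, hW, k, (h1.comp_continuousMap (contRestrict h hWV)).trans k1, k2,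
    fun p x hx => k3 p x (h3 p _ hx), ?_⟩
  rintro p (hp | hp) hρ
  · exact fun x => k3 p x (h4 p hp hρ _)
  · exact k4 p hp hρ

/-- The family of values of a continuous family of sections is jointly continuous. -/
theorem continuous_eval_sections [TopologicalSpace K] {U : Opens X} (f : C(K, ContSections h U)) :
    Continuous fun q : K × U => (f q.1).1 q.2 := by
  have h1 : Continuous fun q : K × U => (f q.1).1 :=
    continuous_subtype_val.comp (f.continuous.comp continuous_fst)
  exact h1.eval continuous_snd

/-- A jointly continuous family of sections, as a continuous map to the space of sections. -/
def sectionFamily [TopologicalSpace K] {U : Opens X} (F : K × U → Z) (hF : Continuous F)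
    (hs : ∀ q, h (F q) = q.2) : C(K, ContSections h U) where
  toFun p := ⟨(ContinuousMap.curry ⟨F, hF⟩) p, fun x => hs (p, x)⟩
  continuous_toFun := (ContinuousMap.curry ⟨F, hF⟩).continuous.subtype_mk _

/-- In a submersion chart, moving the fibre coordinate of a holomorphic section towards a constant
gives a holomorphic section. -/
theorem holomorphicMapAt_interpolate {m : ℕ} {e : OpenPartialHomeomorph Z (X × (Fin m → ℂ))}
    (he : ∀ y ∈ e.source, HolomorphicMapAt e y)
    (he' : ∀ w ∈ e.target, HolomorphicMapAt e.symm w) {V : Opens X} {s : V → Z} {x : V} {τ : ℂ}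
    {v₀ : Fin m → ℂ} (hx : s x ∈ e.source)
    (hxt : ((x : X), (e (s x)).2 + τ • (v₀ - (e (s x)).2)) ∈ e.target)
    (hs : HolomorphicMapAt s x) :
    HolomorphicMapAt (fun y : V => e.symm ((y : X), (e (s y)).2 + τ • (v₀ - (e (s y)).2))) x := by
  have hes : HolomorphicMapAt (fun y => e (s y)) x := (he _ hx).comp hs
  have hc : ContinuousAt (fun y => (e (s y)).2) x := continuousAt_snd.comp hes.1
  refine (he' _ hxt).comp
    (f := fun y : V => ((y : X), (e (s y)).2 + τ • (v₀ - (e (s y)).2)))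
    ((holomorphicMap_subtype_val V x).prodMk_pi ?_ ?_)
  · exact hc.add ((continuousAt_const.sub hc).const_smul τ)
  · intro j
    refine ReducedComplexSpace.HolAt.analyticAt_comp (u := fun y (_ : Unit) => (e (s y)).2 j)
      (G := fun w => w () + τ * (v₀ j - w ())) (fun _ => hes.holAt_snd j) ?_
    have hp : AnalyticAt ℂ (fun w : Unit → ℂ => w ()) (fun _ => (e (s x)).2 j) :=
      (ContinuousLinearMap.proj (R := ℂ) (φ := fun _ : Unit => ℂ) ()).analyticAt _
    exact hp.add (analyticAt_const.mul (analyticAt_const.sub hp))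

/-- The constant sections of a submersion chart are holomorphic. -/
theorem holomorphicMapAt_const_section {m : ℕ} {e : OpenPartialHomeomorph Z (X × (Fin m → ℂ))}
    (he' : ∀ w ∈ e.target, HolomorphicMapAt e.symm w) {V : Opens X} {x : V}
    {v₀ : Fin m → ℂ} (hxt : ((x : X), v₀) ∈ e.target) :
    HolomorphicMapAt (fun y : V => e.symm ((y : X), v₀)) x :=
  (he' _ hxt).comp (f := fun y : V => ((y : X), v₀))
    ((holomorphicMap_subtype_val V x).prodMk_pi continuousAt_const
      fun _ => ReducedComplexSpace.holAt_const _ _)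

/-- A single chart around `F₀ p₀` contains `F₀ p` for all `p` near `p₀`. There the fibre coordinate
of the section is moved towards that of `F₀ p`, with weight `t * ρ * χ` for a bump function `χ` at
`p₀`. -/
theorem IsHolomorphicSubmersion.exists_deformableOn [MetricSpace K] [CompactSpace K]
    (hsub : IsHolomorphicSubmersion h) {x₀ : X} (ρ : C(K, ℝ)) {F₀ : K → Z} (hF₀ : Continuous F₀)
    (p₀ : K) : ∃ S ∈ 𝓝 p₀, DeformableOn h x₀ ρ F₀ S := by
  obtain ⟨m, e, hp₀, heh, he, he'⟩ := hsub.exists_chart (F₀ p₀)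
  obtain ⟨ε, hε, hεs⟩ := Metric.isOpen_iff.1 (e.open_source.preimage hF₀) p₀ hp₀
  -- The bump `χ` is 1 up to distance `δ` and 0 from `2 * δ` on; the chart formula is used below `3
  -- * δ`, which leaves an overlap for gluing.
  obtain ⟨δ, hδ, hδε⟩ : ∃ δ > 0, 3 * δ < ε := ⟨ε / 4, by linarith, by linarith⟩
  refine ⟨Metric.closedBall p₀ δ, Metric.closedBall_mem_nhds _ hδ, fun U hU f hf => ?_⟩
  let χ : K → ℝ := fun p => max 0 (min 1 (2 - dist p p₀ / δ))
  have hχ : Continuous χ := by fun_prop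
  have hχ1 : ∀ p, dist p p₀ ≤ δ → χ p = 1 := fun p hp => by
    have : dist p p₀ / δ ≤ 1 := (div_le_one hδ).2 hp
    simp only [χ]
    rw [min_eq_left (by linarith), max_eq_right zero_le_one]
  have hχ0 : ∀ p, 2 * δ ≤ dist p p₀ → χ p = 0 := fun p hp => by
    have : 2 ≤ dist p p₀ / δ := (le_div_iff₀ hδ).2 hp
    exact max_eq_left ((min_le_right _ _).trans (by linarith))
  -- The weight does not depend on the point of `X`; this is why holomorphy survives the
  -- interpolation.
  let τ : unitInterval × K → ℂ := fun a => ((a.1 : ℝ) * ρ a.2 * χ a.2 : ℝ)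
  have hτ : Continuous τ := by fun_prop
  let F : (unitInterval × K) × U → Z := fun q => (f q.1.2).1 q.2
  have hF : Continuous F := (continuous_eval_sections f).comp
    ((continuous_snd.comp continuous_fst).prodMk continuous_snd)
  have hFh : ∀ q, h (F q) = q.2 := fun q => (f q.1.2).2 q.2
  let w : (unitInterval × K) × U → Fin m → ℂ := fun q =>
    (e (F q)).2 + τ q.1 • ((e (F₀ q.1.2)).2 - (e (F q)).2)
  let c : (unitInterval × K) × U → X × (Fin m → ℂ) := fun q => ((q.2 : X), w q)
  let D : Set ((unitInterval × K) × U) := {q | F q ∈ e.source} ∩ {q | F₀ q.1.2 ∈ e.source}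
  have hF₀' : Continuous fun q : (unitInterval × K) × U => F₀ q.1.2 := by fun_prop
  have hD : IsOpen D := (e.open_source.preimage hF).inter (e.open_source.preimage hF₀')
  have hcD : ContinuousOn c D := by
    have h1 : ContinuousOn (fun q => (e (F q)).2) D :=
      continuous_snd.comp_continuousOn (e.continuousOn.comp hF.continuousOn fun q hq => hq.1)
    have h2 : ContinuousOn (fun q : (unitInterval × K) × U => (e (F₀ q.1.2)).2) D :=
      continuous_snd.comp_continuousOn (e.continuousOn.comp hF₀'.continuousOn fun q hq => hq.2)
    have h3 : Continuous fun q : (unitInterval × K) × U => τ q.1 := hτ.comp continuous_fst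
    have h4 : Continuous fun q : (unitInterval × K) × U => (q.2 : X) := by fun_prop
    exact h4.continuousOn.prodMk (h1.add (h3.continuousOn.smul (h2.sub h1)))
  have hO : IsOpen (D ∩ c ⁻¹' e.target) := hcD.isOpen_inter_preimage hD e.open_target
  have hc_eq : ∀ q, F q ∈ e.source → w q = (e (F q)).2 → c q = e (F q) := fun q hq hw =>
    Prod.ext (by rw [heh _ hq, hFh]) hw
  have hw0 : ∀ q, τ q.1 = 0 → w q = (e (F q)).2 := fun q hq => by simp [w, hq]
  have hwx : ∀ a : unitInterval × K, w (a, ⟨x₀, hU⟩) = (e (F (a, ⟨x₀, hU⟩))).2 := fun a => by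
    simp [w, F, hf]
  have hball : ∀ p, dist p p₀ ≤ 3 * δ → F₀ p ∈ e.source := fun p hp => hεs (hp.trans_lt hδε)
  have hFx₀ : ∀ a : unitInterval × K, F (a, ⟨x₀, hU⟩) = F₀ a.2 := fun a => hf a.2
  -- Over `x₀` nothing moves, so `c` equals `e (F₀ p)` there and lies in the target for all times
  -- and all `p` in the compact ball; the tube lemma gives one neighbourhood of `x₀` for all of
  -- them.
  obtain ⟨u, v, -, hv, hu, hxv, huv⟩ := generalized_tube_lemma
    ((isCompact_univ (X := unitInterval)).prod (isCompact_closedBall p₀ (3 * δ)))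
    (isCompact_singleton (x := (⟨x₀, hU⟩ : U))) hO (by
      rintro ⟨a, x⟩ ⟨ha, rfl⟩
      have h1 : F (a, ⟨x₀, hU⟩) ∈ e.source := by
        rw [hFx₀]
        exact hball _ ha.2
      refine ⟨⟨h1, hball _ ha.2⟩, ?_⟩
      rw [mem_preimage, hc_eq _ h1 (hwx a)]
      exact e.map_source h1)
  let V : Opens X := ⟨Subtype.val '' v, U.isOpen.isOpenMap_subtype_val _ hv⟩
  have hVU : V ≤ U := by
    rintro _ ⟨x, -, rfl⟩
    exact x.2
  have hVv : ∀ x : V, Opens.inclusion hVU x ∈ v := by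
    rintro ⟨_, x, hx, rfl⟩
    exact hx
  let j : (unitInterval × K) × V → (unitInterval × K) × U :=
    fun q => (q.1, Opens.inclusion hVU q.2)
  have hj : Continuous j := by
    have : Continuous (Opens.inclusion hVU) := continuous_inclusion hVU
    fun_prop
  have hjO : ∀ q, dist q.1.2 p₀ < 3 * δ → j q ∈ D ∩ c ⁻¹' e.target := fun q hq =>
    huv ⟨hu ⟨mem_univ _, hq.le⟩, hVv q.2⟩
  let G : (unitInterval × K) × V → Z := fun q =>
    open scoped Classical in if dist q.1.2 p₀ < 3 * δ then e.symm (c (j q)) else F (j q)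
  have hG1 : ∀ q, dist q.1.2 p₀ < 3 * δ → G q = e.symm (c (j q)) := fun q hq => if_pos hq
  -- One criterion for all the places where nothing moves: `t = 0`, `ρ = 0`, `χ = 0`, and the point
  -- `x₀`.
  have hGF : ∀ q, w (j q) = (e (F (j q))).2 → G q = F (j q) := by
    intro q hw
    by_cases hq : dist q.1.2 p₀ < 3 * δ
    · rw [hG1 q hq, hc_eq _ (hjO q hq).1.1 hw, e.left_inv (hjO q hq).1.1]
    · exact if_neg hq
  have hG2 : ∀ q, 2 * δ ≤ dist q.1.2 p₀ → G q = F (j q) := fun q hq =>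
    hGF q (hw0 _ (by simp [τ, j, hχ0 _ hq]))
  have hdist : Continuous fun q : (unitInterval × K) × V => dist q.1.2 p₀ := by fun_prop
  have hG : Continuous G := by
    refine continuous_iff_continuousAt.2 fun q => ?_
    rcases lt_or_ge (dist q.1.2 p₀) (3 * δ) with hq | hq
    · have h1 : ContinuousAt (fun q => e.symm (c (j q))) q :=
        ((e.continuousOn_symm.continuousAt (e.open_target.mem_nhds (hjO q hq).2)).comp
          (hcD.continuousAt (hD.mem_nhds (hjO q hq).1))).comp hj.continuousAt
      refine h1.congr ?_
      filter_upwards [hdist.continuousAt.eventually_lt continuousAt_const hq] with y hy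
      exact (hG1 y hy).symm
    · refine (hF.comp hj).continuousAt.congr ?_
      filter_upwards [continuousAt_const.eventually_lt hdist.continuousAt
        (show 2 * δ < dist q.1.2 p₀ by linarith)] with y hy
      exact (hG2 y hy.le).symm
  have hGh : ∀ q, h (G q) = q.2 := by
    intro q
    by_cases hq : dist q.1.2 p₀ < 3 * δ
    · rw [hG1 q hq, ← heh _ (e.map_target (hjO q hq).2), e.right_inv (hjO q hq).2]
    · rw [hG2 q (by linarith), hFh]
  have hV : x₀ ∈ V := ⟨⟨x₀, hU⟩, hxv rfl, rfl⟩
  let H : C(unitInterval × K, ContSections h V) := sectionFamily G hG hGh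
  let g : C(K, ContSections h V) := H.comp ⟨fun p => (1, p), by fun_prop⟩
  have hHf : ∀ a, τ a = 0 → H a = contRestrict h hVU (f a.2) := fun a ha =>
    Subtype.ext (ContinuousMap.ext fun x => hGF (a, x) (hw0 _ ha))
  refine ⟨V, hVU, hV, g, ⟨⟨⟨H, fun p => hHf _ (by simp [τ]), fun p => rfl⟩, ?_⟩⟩, ?_, ?_, ?_⟩
  · intro t p hp
    exact hHf _ (by simp [τ, show ρ p = 0 from hp])
  · intro p
    exact (hGF ((1, p), ⟨x₀, hV⟩) (hwx _)).trans (hf p)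
  · intro p x hx
    have hx' := hx.comp_inclusion
    by_cases hq : dist p p₀ < 3 * δ
    · have hO1 := hjO ((1, p), x) hq
      have hO2 := hO1.2
      refine (holomorphicMapAt_interpolate (s := fun y => (f p).1 (Opens.inclusion hVU y))
        he he' hO1.1.1 hO2 hx').congr ?_
      exact Filter.Eventually.of_forall fun y => (hG1 ((1, p), y) hq).symm
    · refine hx'.congr (Filter.Eventually.of_forall fun y => ?_)
      exact (hG2 ((1, p), y) (by simp only; linarith)).symm
  · intro p hp hρ x
    have hp' : dist p p₀ ≤ δ := hp
    have hq : dist p p₀ < 3 * δ := by linarith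
    -- With full weight the interpolation has reached the constant section of the chart.
    have hcp : ∀ y : V, c (j ((1, p), y)) = ((y : X), (e (F₀ p)).2) := fun y => by
      have : τ (1, p) = 1 := by simp [τ, hρ, hχ1 p hp']
      simp [c, w, j, this]
    have hO1 := (hjO ((1, p), x) hq).2
    rw [mem_preimage, hcp] at hO1
    refine (holomorphicMapAt_const_section he' hO1).congr (Filter.Eventually.of_forall fun y => ?_)
    exact (congrArg e.symm (hcp y)).symm.trans (hG1 ((1, p), y) hq).symm

/-- A compact family of sections which is holomorphic wherever `ρ ≠ 1` can be deformed, rel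
`{ρ = 0}`, to a family of holomorphic sections near `x₀`. -/
theorem IsHolomorphicSubmersion.exists_homotopicRel_of_cutoff [MetricSpace K] [CompactSpace K]
    (hsub : IsHolomorphicSubmersion h) {x₀ : X} {U : Opens X} (hU : x₀ ∈ U) (ρ : C(K, ℝ))
    (f : C(K, ContSections h U)) (hf : ∀ p, ρ p ≠ 1 → HolomorphicMap ((f p).1 : U → Z)) :
    ∃ (V : Opens X) (hVU : V ≤ U), x₀ ∈ V ∧ ∃ f₁ : C(K, HolSections h V),
      ((contRestrict h hVU).comp f).HomotopicRel ((holInclusion h V).comp f₁) {p | ρ p = 0} := by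
  have hF₀ : Continuous fun p => (f p).1 ⟨x₀, hU⟩ :=
    (continuous_eval_sections f).comp (continuous_id.prodMk continuous_const)
  have key : DeformableOn h x₀ ρ (fun p => (f p).1 ⟨x₀, hU⟩) univ := by
    refine isCompact_univ.induction_on (deformableOn_empty _ _ _) (fun _ _ => .mono)
      (fun _ _ => .union) fun p _ => ?_
    rw [nhdsWithin_univ]
    exact hsub.exists_deformableOn ρ hF₀ p
  obtain ⟨V, hVU, hV, g, h1, -, h3, h4⟩ := key U hU f fun _ => rfl
  -- Where `ρ = 1` holomorphy was produced by the deformation; elsewhere it was there from the start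
  -- and has been preserved.
  have hg : ∀ p, HolomorphicMap ((g p).1 : V → Z) := fun p => by
    by_cases hp : ρ p = 1
    · exact h4 p (mem_univ p) hp
    · exact fun x => h3 p x (hf p hp _)
  exact ⟨V, hVU, hV, ⟨fun p => ⟨g p, hg p⟩, g.continuous.subtype_mk hg⟩, h1⟩

end Deformations

/-! ### Families over balls. -/

section Families

variable {X Z K : Type*} [TopologicalSpace X] [TopologicalSpace Z] [ReducedComplexSpace X]
  [ReducedComplexSpace Z] {h : Z → X}

theorem ContinuousMap.HomotopicRel.mono_set {A B : Type*} [TopologicalSpace A] [TopologicalSpace B]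
    {f g : C(A, B)} {S T : Set A} (hfg : f.HomotopicRel g T) (hST : S ⊆ T) :
    f.HomotopicRel g S :=
  hfg.map fun F => ⟨F.1, fun t x hx => F.2 t x (hST hx)⟩

theorem ContinuousMap.HomotopicRel.comp_right {A B C : Type*} [TopologicalSpace A]
    [TopologicalSpace B] [TopologicalSpace C] {f g : C(A, B)} {S : Set A}
    (hfg : f.HomotopicRel g S) (k : C(C, A)) : (f.comp k).HomotopicRel (g.comp k) (k ⁻¹' S) := by
  obtain ⟨F⟩ := hfg
  exact ⟨⟨⟨⟨fun q => F (q.1, k q.2), by fun_prop⟩, fun x => F.map_zero_left (k x),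
    fun x => F.map_one_left (k x)⟩, fun t x hx => F.2 t (k x) hx⟩⟩

section Ball

variable {E : Type*} [NormedAddCommGroup E] [NormedSpace ℝ E]

/-- The radial stretching of a closed ball, which at time `1` maps the outer half of the ball to
its boundary sphere. -/
theorem exists_radial_stretch (c : E) {r : ℝ} (hr : 0 < r) :
    ∃ φ : C(unitInterval × Metric.closedBall c r, Metric.closedBall c r),
      (∀ p, φ (0, p) = p) ∧ (∀ t p, p.1 ∈ Metric.sphere c r → φ (t, p) = p) ∧
      ∀ p, r / 2 < dist p.1 c → (φ (1, p)).1 ∈ Metric.sphere c r := by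
  -- Division by `μ` doubles the inner half ball, projects the outer shell radially to the sphere,
  -- and is the identity on the sphere.
  let μ : E → ℝ := fun v => max (1 / 2) (‖v‖ / r)
  have hμ0 : ∀ v, 0 < μ v := fun v => lt_of_lt_of_le (by norm_num) (le_max_left _ _)
  have hμ : Continuous μ := by fun_prop
  let ψ : unitInterval × E → E := fun q => c + ((1 - (q.1 : ℝ)) + q.1 * (μ (q.2 - c))⁻¹) • (q.2 - c)
  have hψ : Continuous ψ := by
    have h1 : Continuous fun q : unitInterval × E => (μ (q.2 - c))⁻¹ :=
      (hμ.comp (by fun_prop)).inv₀ fun q => (hμ0 _).ne'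
    fun_prop
  have hmem : ∀ q : unitInterval × Metric.closedBall c r,
      ψ (q.1, q.2) ∈ Metric.closedBall c r := by
    rintro ⟨t, p, hp⟩
    rw [mem_closedBall_iff_norm] at hp
    have h1 : (μ (p - c))⁻¹ * ‖p - c‖ ≤ r := by
      rw [inv_mul_le_iff₀ (hμ0 _), ← div_le_iff₀ hr]
      exact le_max_right _ _
    have ht0 := t.2.1
    have ht1 := t.2.2
    have hpos : 0 ≤ (1 - (t : ℝ)) + t * (μ (p - c))⁻¹ :=
      add_nonneg (by linarith) (mul_nonneg ht0 (inv_nonneg.2 (hμ0 _).le))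
    rw [mem_closedBall_iff_norm, add_sub_cancel_left, norm_smul, Real.norm_of_nonneg hpos, add_mul,
      mul_assoc]
    have h2 := mul_le_mul_of_nonneg_left hp (show 0 ≤ 1 - (t : ℝ) by linarith)
    have h3 := mul_le_mul_of_nonneg_left h1 ht0
    linarith
  refine ⟨⟨fun q => ⟨ψ (q.1, q.2), hmem q⟩, ?_⟩, ?_, ?_, ?_⟩
  · exact (hψ.comp (by fun_prop)).subtype_mk _
  · intro p
    exact Subtype.ext (by simp [ψ])
  · intro t p hp
    rw [mem_sphere_iff_norm] at hp
    have h1 : μ (p.1 - c) = 1 := by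
      simp only [μ, hp, div_self hr.ne']
      norm_num
    exact Subtype.ext (by simp [ψ, h1])
  · intro p hp
    rw [dist_eq_norm] at hp
    have h1 : μ (p.1 - c) = ‖p.1 - c‖ / r :=
      max_eq_right ((le_div_iff₀ hr).2 (by linarith))
    have h2 : 0 < ‖p.1 - c‖ := by linarith
    rw [mem_sphere_iff_norm]
    simp only [ContinuousMap.coe_mk, ψ, h1, Icc.coe_one, sub_self, zero_add, one_mul,
      add_sub_cancel_left, norm_smul, norm_inv, norm_div, norm_norm, Real.norm_of_nonneg hr.le]
    field_simp

/-- A family of sections parametrized by a closed ball and holomorphic over the boundary sphere can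
be deformed near `x₀`, rel the sphere, to a family of holomorphic sections. -/
theorem IsHolomorphicSubmersion.exists_homotopicRel_closedBall [ProperSpace E]
    (hsub : IsHolomorphicSubmersion h) {x₀ : X} {U : Opens X} (hU : x₀ ∈ U) (c : E) {r : ℝ}
    (hr : 0 < r) (f : C(Metric.closedBall c r, ContSections h U))
    (hf : ∀ p, p.1 ∈ Metric.sphere c r → HolomorphicMap ((f p).1 : U → Z)) :
    ∃ (V : Opens X) (hVU : V ≤ U), x₀ ∈ V ∧
      ∃ f₁ : C(Metric.closedBall c r, HolSections h V),
        ((contRestrict h hVU).comp f).HomotopicRel ((holInclusion h V).comp f₁)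
          {p | p.1 ∈ Metric.sphere c r} := by
  obtain ⟨φ, hφ0, hφs, hφ1⟩ := exists_radial_stretch c hr
  have : CompactSpace (Metric.closedBall c r) :=
    isCompact_iff_compactSpace.1 (isCompact_closedBall c r)
  -- This is 0 on the sphere and differs from 1 only at distance more than `r / 2`, where the
  -- stretched family takes boundary values of `f` and so is holomorphic.
  let ρ : C(Metric.closedBall c r, ℝ) := ⟨fun p => min 1 (2 - 2 * (dist p.1 c / r)), by fun_prop⟩
  let f' : C(Metric.closedBall c r, ContSections h U) :=
    (f.comp φ).comp ⟨fun p => (1, p), by fun_prop⟩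
  have hff' : f.HomotopicRel f' {p | p.1 ∈ Metric.sphere c r} :=
    ⟨⟨⟨f.comp φ, fun p => congrArg f (hφ0 p), fun p => rfl⟩,
      fun t p hp => congrArg f (hφs t p hp)⟩⟩
  obtain ⟨V, hVU, hV, f₁, H⟩ := hsub.exists_homotopicRel_of_cutoff hU ρ f' (by
    intro p hp
    refine hf _ (hφ1 p ?_)
    by_contra! hlt
    refine hp (min_eq_left ?_)
    have : dist p.1 c / r ≤ 1 / 2 := (div_le_iff₀ hr).2 (by linarith)
    linarith)
  refine ⟨V, hVU, hV, f₁, (hff'.comp_continuousMap _).trans (H.mono_set fun p hp => ?_)⟩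
  have hp' : dist p.1 c = r := hp
  simp [ρ, hp', hr.ne']

/-- The deformation over a compact space embedded onto a closed ball. -/
theorem IsHolomorphicSubmersion.exists_homotopicRel_of_range_eq [ProperSpace E]
    [TopologicalSpace K] [CompactSpace K]
    (hsub : IsHolomorphicSubmersion h) {x₀ : X} {U : Opens X} (hU : x₀ ∈ U) {c : E} {r : ℝ}
    (hr : 0 < r) {j : K → E} (hj : Continuous j) (hji : Function.Injective j)
    (hjr : range j = Metric.closedBall c r) (f : C(K, ContSections h U))
    (hf : ∀ p, j p ∈ Metric.sphere c r → HolomorphicMap ((f p).1 : U → Z)) :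
    ∃ (V : Opens X) (hVU : V ≤ U), x₀ ∈ V ∧ ∃ f₁ : C(K, HolSections h V),
        ((contRestrict h hVU).comp f).HomotopicRel ((holInclusion h V).comp f₁)
          {p | j p ∈ Metric.sphere c r} := by
  let Φ : K ≃ₜ Metric.closedBall c r :=
    (hj.isClosedEmbedding hji).isEmbedding.toHomeomorph.trans (Homeomorph.setCongr hjr)
  have hΦ : ∀ p, (Φ p).1 = j p := fun p => rfl
  let a : C(K, Metric.closedBall c r) := ⟨Φ, Φ.continuous⟩
  obtain ⟨V, hVU, hV, f₁, H⟩ := hsub.exists_homotopicRel_closedBall hU c hr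
    (f.comp ⟨Φ.symm, Φ.symm.continuous⟩) (fun p hp => hf _ (by
      rw [← hΦ]
      exact (Φ.apply_symm_apply p).symm ▸ hp))
  have e : (((contRestrict h hVU).comp (f.comp ⟨Φ.symm, Φ.symm.continuous⟩)).comp a) =
      (contRestrict h hVU).comp f := by
    ext1 p
    simp [a]
  have H' := H.comp_right a
  rw [e] at H'
  exact ⟨V, hVU, hV, f₁.comp a, H'⟩

end Ball

/-! ### Cubes as balls, and homotopy groups. -/

theorem unitInterval.dist_half_le (t : unitInterval) : dist (t : ℝ) (1 / 2) ≤ 1 / 2 := by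
  rw [Real.dist_eq, abs_le]
  constructor <;> linarith [t.2.1, t.2.2]

theorem unitInterval.dist_half_lt_iff (t : unitInterval) :
    dist (t : ℝ) (1 / 2) < 1 / 2 ↔ ¬(t = 0 ∨ t = 1) := by
  have h0 : t = 0 ↔ (t : ℝ) = 0 := Subtype.ext_iff
  have h1 : t = 1 ↔ (t : ℝ) = 1 := Subtype.ext_iff
  rw [Real.dist_eq, abs_lt, h0, h1, not_or]
  constructor
  · rintro ⟨h2, h3⟩
    constructor <;> intro h4 <;> linarith
  · rintro ⟨h2, h3⟩
    have h4 := lt_of_le_of_ne t.2.1 (Ne.symm h2)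
    have h5 := lt_of_le_of_ne t.2.2 h3
    constructor <;> linarith

theorem mem_unitInterval_of_dist_half_le {t : ℝ} (ht : dist t (1 / 2) ≤ 1 / 2) :
    t ∈ unitInterval := by
  rw [Real.dist_eq, abs_le] at ht
  constructor <;> linarith [ht.1, ht.2]

theorem Cube.dist_half_le {n : ℕ} (y : Fin n → unitInterval) :
    dist (fun i => (y i : ℝ)) (fun _ => 1 / 2) ≤ 1 / 2 :=
  (dist_pi_le_iff (by norm_num)).2 fun i => unitInterval.dist_half_le (y i)

theorem Cube.dist_half_lt_iff {n : ℕ} (y : Fin n → unitInterval) :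
    dist (fun i => (y i : ℝ)) (fun _ => 1 / 2) < 1 / 2 ↔ y ∉ Cube.boundary (Fin n) := by
  rw [dist_pi_lt_iff (by norm_num)]
  simp only [unitInterval.dist_half_lt_iff, Cube.boundary]
  exact not_exists.symm

/-- The cube is the sup-norm ball of radius 1/2 about its centre, with `Cube.boundary` as its
sphere. For `n = 0` it is a point with empty boundary. -/
theorem IsHolomorphicSubmersion.exists_homotopicRel_cube
    (hsub : IsHolomorphicSubmersion h) {x₀ : X} {U : Opens X} (hU : x₀ ∈ U) {n : ℕ}
    (f : C(Fin n → unitInterval, ContSections h U))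
    (hf : ∀ y ∈ Cube.boundary (Fin n), HolomorphicMap ((f y).1 : U → Z)) :
    ∃ (V : Opens X) (hVU : V ≤ U), x₀ ∈ V ∧ ∃ f₁ : C(Fin n → unitInterval, HolSections h V),
      ((contRestrict h hVU).comp f).HomotopicRel ((holInclusion h V).comp f₁)
        (Cube.boundary (Fin n)) := by
  have key : ∀ y : Fin n → unitInterval,
      (fun i => (y i : ℝ)) ∈ Metric.sphere (fun _ => 1 / 2) (1 / 2) ↔
        y ∈ Cube.boundary (Fin n) := by
    intro y
    rw [← not_iff_not, ← Cube.dist_half_lt_iff, Metric.mem_sphere]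
    exact (Cube.dist_half_le y).lt_iff_ne.symm
  obtain ⟨V, hVU, hV, f₁, H⟩ := hsub.exists_homotopicRel_of_range_eq hU
    (c := (fun _ : Fin n => (1 / 2 : ℝ))) (r := 1 / 2) (by norm_num)
    (j := fun (y : Fin n → unitInterval) i => (y i : ℝ)) (by fun_prop)
    (fun y z hyz => funext fun i => Subtype.ext (congrFun hyz i)) (by
      refine Subset.antisymm (range_subset_iff.2 Cube.dist_half_le) fun y hy => ?_
      rw [Metric.mem_closedBall, dist_pi_le_iff (by norm_num)] at hy
      exact ⟨fun i => ⟨y i, mem_unitInterval_of_dist_half_le (hy i)⟩, rfl⟩) f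
    (fun y hy => hf y ((key y).1 hy))
  exact ⟨V, hVU, hV, f₁, H.mono_set fun y hy => (key y).2 hy⟩

/-- The prism is again a sup-norm ball. It serves for homotopies, whose two ends and sides make up
the sphere. -/
theorem IsHolomorphicSubmersion.exists_homotopicRel_prod_cube
    (hsub : IsHolomorphicSubmersion h) {x₀ : X} {U : Opens X} (hU : x₀ ∈ U) {n : ℕ}
    (f : C(unitInterval × (Fin n → unitInterval), ContSections h U))
    (hf : ∀ q : unitInterval × (Fin n → unitInterval),
      ((q.1 = 0 ∨ q.1 = 1) ∨ q.2 ∈ Cube.boundary (Fin n)) → HolomorphicMap ((f q).1 : U → Z)) :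
    ∃ (V : Opens X) (hVU : V ≤ U), x₀ ∈ V ∧
      ∃ f₁ : C(unitInterval × (Fin n → unitInterval), HolSections h V),
        ((contRestrict h hVU).comp f).HomotopicRel ((holInclusion h V).comp f₁)
          {q | (q.1 = 0 ∨ q.1 = 1) ∨ q.2 ∈ Cube.boundary (Fin n)} := by
  have key : ∀ q : unitInterval × (Fin n → unitInterval),
      (((q.1 : ℝ), fun i => (q.2 i : ℝ)) : ℝ × (Fin n → ℝ)) ∈
        Metric.sphere (1 / 2, fun _ => 1 / 2) (1 / 2) ↔
        (q.1 = 0 ∨ q.1 = 1) ∨ q.2 ∈ Cube.boundary (Fin n) := by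
    intro q
    rw [← not_iff_not, not_or, ← Cube.dist_half_lt_iff, ← unitInterval.dist_half_lt_iff,
      Metric.mem_sphere, ← max_lt_iff]
    exact (max_le (unitInterval.dist_half_le q.1) (Cube.dist_half_le q.2)).lt_iff_ne.symm
  obtain ⟨V, hVU, hV, f₁, H⟩ := hsub.exists_homotopicRel_of_range_eq hU
    (c := ((1 / 2, fun _ => 1 / 2) : ℝ × (Fin n → ℝ))) (r := 1 / 2) (by norm_num)
    (j := fun q : unitInterval × (Fin n → unitInterval) => ((q.1 : ℝ), fun i => (q.2 i : ℝ)))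
    (by fun_prop)
    (fun y z hyz => Prod.ext (Subtype.ext (congrArg Prod.fst hyz))
      (funext fun i => Subtype.ext (congrFun (congrArg Prod.snd hyz) i))) (by
      refine Subset.antisymm (range_subset_iff.2 fun q =>
        max_le (unitInterval.dist_half_le q.1) (Cube.dist_half_le q.2)) ?_
      rintro ⟨t, y⟩ hy
      have hy' := max_le_iff.1 (Metric.mem_closedBall.1 hy)
      have hy2 := (dist_pi_le_iff (by norm_num)).1 hy'.2
      exact ⟨(⟨t, mem_unitInterval_of_dist_half_le hy'.1⟩,
        fun i => ⟨y i, mem_unitInterval_of_dist_half_le (hy2 i)⟩), rfl⟩) f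
    (fun y hy => hf y ((key y).1 hy))
  exact ⟨V, hVU, hV, f₁, H.mono_set fun y hy => (key y).2 hy⟩

/-- Surjectivity deforms a representing cube, injectivity a homotopy between holomorphic
representatives. Since the deformation fixes the boundary, the new family keeps its base point, and
in the second case also its two ends. `π₀` is the case `n = 0`. -/
theorem IsHolomorphicSubmersion.isLocalWeakHomotopyEquiv (hsub : IsHolomorphicSubmersion h) :
    IsLocalWeakHomotopyEquiv h where
  pi_zero_surjective x₀ U hU s := by
    obtain ⟨V, hVU, hV, f₁, ⟨H⟩⟩ := hsub.exists_homotopicRel_cube hU (n := 0)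
      (ContinuousMap.const _ s) (fun y hy => hy.elim fun i _ => i.elim0)
    exact ⟨V, hVU, hV, f₁ 0, ⟨(H.evalAt 0).symm⟩⟩
  pi_zero_injective x₀ U hU σ τ := by
    rintro ⟨γ⟩
    obtain ⟨V, hVU, hV, f₁, H⟩ := hsub.exists_homotopicRel_prod_cube hU (n := 0)
      (γ.toContinuousMap.comp ⟨Prod.fst, continuous_fst⟩) (by
        rintro ⟨t, y⟩ ((rfl | rfl) | ⟨i, -⟩)
        · exact (congrArg (fun s : ContSections h U => HolomorphicMap (s.1 : U → Z)) γ.source).mpr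
            σ.2
        · exact (congrArg (fun s : ContSections h U => HolomorphicMap (s.1 : U → Z)) γ.target).mpr
            τ.2
        · exact i.elim0)
    have h0 := H.fst_eq_snd (x := (0, 0)) (Or.inl (Or.inl rfl))
    have h1 := H.fst_eq_snd (x := (1, 0)) (Or.inl (Or.inr rfl))
    refine ⟨V, hVU, hV, ⟨⟨f₁.comp ⟨fun t => (t, 0), by fun_prop⟩, ?_, ?_⟩⟩⟩
    · refine Subtype.ext (h0.symm.trans ?_)
      exact congrArg (contRestrict h hVU) γ.source
    · refine Subtype.ext (h1.symm.trans ?_)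
      exact congrArg (contRestrict h hVU) γ.target
  pi_surjective x₀ U hU σ n _ α := by
    obtain ⟨γ, rfl⟩ := Quotient.exists_rep α
    obtain ⟨V, hVU, hV, f₁, H⟩ := hsub.exists_homotopicRel_cube hU γ.1 (fun y hy => by
      rw [γ.2 y hy]
      exact σ.2)
    refine ⟨V, hVU, hV, Quotient.mk _ ⟨f₁, fun y hy => Subtype.ext ?_⟩, Quotient.sound H.symm⟩
    exact (H.fst_eq_snd hy).symm.trans (congrArg (contRestrict h hVU) (γ.2 y hy))
  pi_injective x₀ U hU σ n _ α β hαβ := by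
    obtain ⟨γ, rfl⟩ := Quotient.exists_rep α
    obtain ⟨δ, rfl⟩ := Quotient.exists_rep β
    obtain ⟨G⟩ : ((holInclusion h U).comp γ.1).HomotopicRel ((holInclusion h U).comp δ.1)
      (Cube.boundary (Fin n)) := Quotient.exact hαβ
    have hG0 : ∀ y, G (0, y) = holInclusion h U (γ.1 y) := G.map_zero_left
    have hG1 : ∀ y, G (1, y) = holInclusion h U (δ.1 y) := G.map_one_left
    have hGb : ∀ t, ∀ y ∈ Cube.boundary (Fin n), G (t, y) = holInclusion h U (γ.1 y) :=
      fun t y hy => G.eq_fst t hy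
    obtain ⟨V, hVU, hV, f₁, H⟩ := hsub.exists_homotopicRel_prod_cube hU G.toContinuousMap (by
      rintro ⟨t, y⟩ ((rfl | rfl) | hy)
      · exact (congrArg (fun s : ContSections h U => HolomorphicMap (s.1 : U → Z)) (hG0 y)).mpr
          (γ.1 y).2
      · exact (congrArg (fun s : ContSections h U => HolomorphicMap (s.1 : U → Z)) (hG1 y)).mpr
          (δ.1 y).2
      · exact (congrArg (fun s : ContSections h U => HolomorphicMap (s.1 : U → Z))
          (hGb t y hy)).mpr (γ.1 y).2)
    refine ⟨V, hVU, hV, Quotient.sound ⟨⟨⟨f₁, fun y => Subtype.ext ?_, fun y => Subtype.ext ?_⟩,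
      fun t y hy => Subtype.ext ?_⟩⟩⟩
    · exact (H.fst_eq_snd (x := (0, y)) (Or.inl (Or.inl rfl))).symm.trans
        (congrArg (contRestrict h hVU) (hG0 y))
    · exact (H.fst_eq_snd (x := (1, y)) (Or.inl (Or.inr rfl))).symm.trans
        (congrArg (contRestrict h hVU) (hG1 y))
    · exact (H.fst_eq_snd (x := (t, y)) (Or.inr hy)).symm.trans
        (congrArg (contRestrict h hVU) (hGb t y hy))

end Families

theorem mainTheorem11 {X Z : Type*} [TopologicalSpace X] [TopologicalSpace Z]
    [ReducedComplexSpace X] [ReducedComplexSpace Z] (h : Z → X)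
    (hsub : IsHolomorphicSubmersion h) (hsurj : Function.Surjective h) :
    (∀ (x₀ : X) (U : Opens X), x₀ ∈ U →
      ∀ (n : ℕ) (c : EuclideanSpace ℝ (Fin n)) (r : ℝ), 0 < r →
      ∀ f : C(Metric.closedBall c r, ContSections h U),
      (∀ p, p.1 ∈ Metric.sphere c r → HolomorphicMap ((f p).1 : U → Z)) →
      ∃ (V : Opens X) (hVU : V ≤ U), x₀ ∈ V ∧
        ∃ f₁ : C(Metric.closedBall c r, HolSections h V),
          ((contRestrict h hVU).comp f).HomotopicRel ((holInclusion h V).comp f₁)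
            {p | p.1 ∈ Metric.sphere c r}) ∧
    IsLocalWeakHomotopyEquiv h :=
  ⟨fun _ _ hU _ c _ hr f hf => hsub.exists_homotopicRel_closedBall hU c hr f hf,
    hsub.isLocalWeakHomotopyEquiv⟩
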